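/- **Setting.** Let $X$ be a set, and let $\mathcal U,\mathcal V$ be real Banach spaces of real-valued functions on $X$ with continuous point evaluations. For $a,b\colon X\to\mathbb R$ put $(a\otimes b)(x_1,x_2)=a(x_1)b(x_2)$. For each pair $(\mathcal A,\mathcal B)$ with $\mathcal A,\mathcal B\in\{\mathcal U,\mathcal V\}$ let $\mathcal A\hat\otimes\mathcal B$ be a Banach completion of $\mathcal A\otimes\mathcal B=\operatorname{span}\{a\otimes b: a\in\mathcal A,\,b\in\mathcal B\}$, realised as a Banach space of functions on $X\times X$ with continuous point evaluations, for a norm such that $\|a\otimes b\|\le C\|a\|\|b\|$ and, for bounded functionals $\varphi\in\mathcal A'$, $\psi\in\mathcal B'$, the functional $a\otimes b\mapsto\varphi(a)\psi(b)$ extends to a bounded functional on $\mathcal A\hat\otimes\mathcal B$ of norm at most $C'\|\varphi\|\|\psi\|$ (the constants being independent of $a,b,\varphi,\psi$). Let $T\colon\operatorname{dom}(T)\subseteq\mathcal U\to\mathcal V$ be a closed linear operator. Let $(\Omega,\Sigma,\mathbb P)$ be a probability space, let $u\colon\Omega\times X\to\mathbb R$ be a stochastic process with $u(\omega,\cdot)\in\operatorname{dom}(T)$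 for $\mathbb P$-a.e. $\omega$, and let $v\colon\Omega\times X\to\mathbb R$ satisfy $v(\omega,\cdot)=T\,u(\omega,\cdot)$ for $\mathbb P$-a.e. $\omega$. For a process $w$ write $m_w(x)=\mathbb E[w(x)]$ and $k_w(x_1,x_2)=\operatorname{Cov}[w(x_1),w(x_2)]$; $w\sim\mathcal{GP}(m,k)$ means that all finite-dimensional marginals of $w$ are (possibly degenerate) Gaussian with mean and covariance given by $m$ and $k$. **(a) (Mean function.)** Suppose that $u$ and $v$ are Bochner integrable as $\mathcal U$- and $\mathcal V$-valued random variables. Then their Bochner means are the mean functions $m_u\in\mathcal U$ and $m_v\in\mathcal V$, $m_u\in\operatorname{dom}(T)$, and $m_v=Tm_u$. **(b) (Covariance function.)** Suppose in addition that $T$ and its adjoint $T^*\colon\operatorname{dom}(T^*)\subseteq\mathcal V'\to\mathcal U'$ are densely defined, and that $\mathbb E\|u\|_{\mathcal U}^2<\infty$ and $\mathbb E\|v\|_{\mathcal V}^2<\infty$. Then the operators $T\otimes I$, from $\mathcal U\hat\otimes\mathcal A$ to $\mathcal V\hat\otimes\mathcal A$, and $I\otimes T$, from $\mathcal A\hat\otimes\mathcal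 U$ to $\mathcal A\hat\otimes\mathcal V$, for $\mathcal A\in\{\mathcal U,\mathcal V\}$ (with domains $\operatorname{dom}(T)\otimes\mathcal A$ and $\mathcal A\otimes\operatorname{dom}(T)$) are closable with densely defined closures, denoted $T_1$ and $T_2$ respectively. Moreover $u$ and $v$ have covariance functions $k_u\in\mathcal U\hat\otimes\mathcal U$ and $k_v\in\mathcal V\hat\otimes\mathcal V$, both compositions $T_1T_2$ and $T_2T_1$ are defined at $k_u$, and $$k_v=T_1T_2k_u=T_2T_1k_u .$$ **(c) (Gaussianity.)** Suppose in addition to the hypotheses of (a) and (b) that $u\sim\mathcal{GP}(m_u,k_u)$ and that $\mathbb E\|v\|_{\mathcal V}^n<\infty$ for all $n\in\mathbb N$. Then $v\sim\mathcal{GP}(Tm_u,\,T_1T_2k_u)$. -/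

import Mathlib

open MeasureTheory ProbabilityTheory
open scoped ENNReal

/-- A normed space `U` of real-valued functions on `X`, with continuous point evaluations: a
continuous linear injection of `U` into `X → ℝ` (product topology). A Banach space of functions
is a `BanachFunctionSpace` with `CompleteSpace U`. -/
class BanachFunctionSpace (X : outParam Type*) (U : Type*)
    [NormedAddCommGroup U] [NormedSpace ℝ U] where
  /-- The inclusion of `U` into the functions on `X`. -/
  coeCLM : U →L[ℝ] (X → ℝ)
  coeCLM_injective : Function.Injective coeCLM

namespace BanachFunctionSpace

variable {X U : Type*} [NormedAddCommGroup U] [NormedSpace ℝ U] [BanachFunctionSpace X U]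

instance instFunLike : FunLike U X ℝ where
  coe f := coeCLM f
  coe_injective := coeCLM_injective

theorem add_apply (f g : U) (x : X) : (f + g) x = f x + g x :=
  congrFun (map_add (coeCLM (U := U)) f g) x

theorem smul_apply (c : ℝ) (f : U) (x : X) : (c • f) x = c * f x :=
  congrFun (map_smul (coeCLM (U := U)) c f) x

theorem zero_apply (x : X) : (0 : U) x = 0 :=
  congrFun (map_zero (coeCLM (U := U))) x

end BanachFunctionSpace

section Tensor

variable {X U V E W W₁ W₂ : Type*}
  [NormedAddCommGroup U] [NormedSpace ℝ U] [BanachFunctionSpace X U]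
  [NormedAddCommGroup V] [NormedSpace ℝ V] [BanachFunctionSpace X V]
  [NormedAddCommGroup E] [NormedSpace ℝ E] [BanachFunctionSpace X E]
  [NormedAddCommGroup W] [NormedSpace ℝ W] [BanachFunctionSpace (X × X) W]
  [NormedAddCommGroup W₁] [NormedSpace ℝ W₁] [BanachFunctionSpace (X × X) W₁]
  [NormedAddCommGroup W₂] [NormedSpace ℝ W₂] [BanachFunctionSpace (X × X) W₂]

/-- `w = a ⊗ b`, i.e. `w (x₁, x₂) = a x₁ * b x₂`. -/
def IsTmul (a : U) (b : E) (w : W) : Prop :=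
  ∀ x₁ x₂ : X, w (x₁, x₂) = a x₁ * b x₂

/-- The space `W` of functions on `X × X` is a completion of
`U ⊗ E = span {a ⊗ b}` for a reasonable tensor norm (up to constants): it contains all `a ⊗ b`,
their span is dense, `‖a ⊗ b‖ ≤ C ‖a‖ ‖b‖`, and for bounded functionals `φ` on `U` and `ψ` on `E`,
`φ ⊗ ψ` extends to a bounded functional on `W` with `‖φ ⊗ ψ‖ ≤ C' ‖φ‖ ‖ψ‖`. -/
structure IsTensorCompletion (U E W : Type*)
    [NormedAddCommGroup U] [NormedSpace ℝ U] [BanachFunctionSpace X U]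
    [NormedAddCommGroup E] [NormedSpace ℝ E] [BanachFunctionSpace X E]
    [NormedAddCommGroup W] [NormedSpace ℝ W] [BanachFunctionSpace (X × X) W] : Prop where
  complete : CompleteSpace W
  exists_tmul : ∀ (a : U) (b : E), ∃ w : W, IsTmul a b w
  dense_span : Dense (Submodule.span ℝ {w : W | ∃ (a : U) (b : E), IsTmul a b w} : Set W)
  norm_tmul_le : ∃ C : ℝ, ∀ (a : U) (b : E) (w : W), IsTmul a b w → ‖w‖ ≤ C * ‖a‖ * ‖b‖
  exists_dual_tmul : ∃ C : ℝ, ∀ (φ : StrongDual ℝ U) (ψ : StrongDual ℝ E),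
    ∃ Φ : StrongDual ℝ W, ‖Φ‖ ≤ C * ‖φ‖ * ‖ψ‖ ∧
      ∀ (a : U) (b : E) (w : W), IsTmul a b w → Φ w = φ a * ψ b

/-- The graph of `T ⊗ I`, spanned by the pairs `(a ⊗ b, T a ⊗ b)`, `a ∈ dom T`, `b ∈ E`. -/
def tensorLeftGraph (T : U →ₗ.[ℝ] V) (E W₁ W₂ : Type*)
    [NormedAddCommGroup E] [NormedSpace ℝ E] [BanachFunctionSpace X E]
    [NormedAddCommGroup W₁] [NormedSpace ℝ W₁] [BanachFunctionSpace (X × X) W₁]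
    [NormedAddCommGroup W₂] [NormedSpace ℝ W₂] [BanachFunctionSpace (X × X) W₂] :
    Submodule ℝ (W₁ × W₂) :=
  Submodule.span ℝ {p | ∃ (a : T.domain) (b : E), IsTmul (a : U) b p.1 ∧ IsTmul (T a) b p.2}

/-- The graph of `I ⊗ T`, spanned by the pairs `(b ⊗ a, b ⊗ T a)`, `b ∈ E`, `a ∈ dom T`. -/
def tensorRightGraph (T : U →ₗ.[ℝ] V) (E W₁ W₂ : Type*)
    [NormedAddCommGroup E] [NormedSpace ℝ E] [BanachFunctionSpace X E]
    [NormedAddCommGroup W₁] [NormedSpace ℝ W₁] [BanachFunctionSpace (X × X) W₁]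
    [NormedAddCommGroup W₂] [NormedSpace ℝ W₂] [BanachFunctionSpace (X × X) W₂] :
    Submodule ℝ (W₁ × W₂) :=
  Submodule.span ℝ {p | ∃ (b : E) (a : T.domain), IsTmul b (a : U) p.1 ∧ IsTmul b (T a) p.2}

/-- The operator `T ⊗ I` from `U ⊗ E` (inside its completion `W₁`) to `V ⊗ E` (inside its
completion `W₂`), with domain `dom T ⊗ E`. -/
noncomputable def tensorLeft (T : U →ₗ.[ℝ] V) (E W₁ W₂ : Type*)
    [NormedAddCommGroup E] [NormedSpace ℝ E] [BanachFunctionSpace X E]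
    [NormedAddCommGroup W₁] [NormedSpace ℝ W₁] [BanachFunctionSpace (X × X) W₁]
    [NormedAddCommGroup W₂] [NormedSpace ℝ W₂] [BanachFunctionSpace (X × X) W₂] :
    W₁ →ₗ.[ℝ] W₂ :=
  (tensorLeftGraph T E W₁ W₂).toLinearPMap

/-- The operator `I ⊗ T` from `E ⊗ U` (inside its completion `W₁`) to `E ⊗ V` (inside its
completion `W₂`), with domain `E ⊗ dom T`. -/
noncomputable def tensorRight (T : U →ₗ.[ℝ] V) (E W₁ W₂ : Type*)
    [NormedAddCommGroup E] [NormedSpace ℝ E] [BanachFunctionSpace X E]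
    [NormedAddCommGroup W₁] [NormedSpace ℝ W₁] [BanachFunctionSpace (X × X) W₁]
    [NormedAddCommGroup W₂] [NormedSpace ℝ W₂] [BanachFunctionSpace (X × X) W₂] :
    W₁ →ₗ.[ℝ] W₂ :=
  (tensorRightGraph T E W₁ W₂).toLinearPMap

/-- The graph of `T ⊗ I` is the graph of an operator: `T ⊗ I` is well defined. -/
theorem tensorLeft_graph (T : U →ₗ.[ℝ] V) :
    (tensorLeft T E W₁ W₂).graph = tensorLeftGraph T E W₁ W₂ := by
  have key : ∀ p ∈ tensorLeftGraph T E W₁ W₂, ∀ y : X, ∃ a : T.domain,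
      ∀ x, p.1 (x, y) = (a : U) x ∧ p.2 (x, y) = (T a) x := by
    intro p hp y
    induction hp using Submodule.span_induction with
    | mem p hp =>
      obtain ⟨a, b, h₁, h₂⟩ := hp
      refine ⟨b y • a, fun x => ⟨?_, ?_⟩⟩
      · rw [h₁, Submodule.coe_smul, BanachFunctionSpace.smul_apply, mul_comm]
      · rw [h₂, LinearPMap.map_smul, BanachFunctionSpace.smul_apply, mul_comm]
    | zero =>
      refine ⟨0, fun x => ⟨?_, ?_⟩⟩
      · simp [BanachFunctionSpace.zero_apply]
      · simp [BanachFunctionSpace.zero_apply]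
    | add p q _ _ hp hq =>
      obtain ⟨a, ha⟩ := hp
      obtain ⟨b, hb⟩ := hq
      refine ⟨a + b, fun x => ⟨?_, ?_⟩⟩
      · rw [Prod.fst_add, Submodule.coe_add, BanachFunctionSpace.add_apply,
          BanachFunctionSpace.add_apply, (ha x).1, (hb x).1]
      · rw [Prod.snd_add, LinearPMap.map_add, BanachFunctionSpace.add_apply,
          BanachFunctionSpace.add_apply, (ha x).2, (hb x).2]
    | smul c p _ hp =>
      obtain ⟨a, ha⟩ := hp
      refine ⟨c • a, fun x => ⟨?_, ?_⟩⟩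
      · rw [Prod.smul_fst, Submodule.coe_smul, BanachFunctionSpace.smul_apply,
          BanachFunctionSpace.smul_apply, (ha x).1]
      · rw [Prod.smul_snd, LinearPMap.map_smul, BanachFunctionSpace.smul_apply,
          BanachFunctionSpace.smul_apply, (ha x).2]
  refine Submodule.toLinearPMap_graph_eq _ fun p hp h0 => ?_
  refine DFunLike.ext _ _ fun z => ?_
  obtain ⟨a, ha⟩ := key p hp z.2
  have ha0 : a = 0 := by
    refine Subtype.ext (DFunLike.ext _ _ fun x => ?_)
    rw [← (ha x).1, h0, BanachFunctionSpace.zero_apply, Submodule.coe_zero,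
      BanachFunctionSpace.zero_apply]
  have h := (ha z.1).2
  rwa [ha0, LinearPMap.map_zero, BanachFunctionSpace.zero_apply,
    ← BanachFunctionSpace.zero_apply (U := W₂) z] at h

/-- The graph of `I ⊗ T` is the graph of an operator: `I ⊗ T` is well defined. -/
theorem tensorRight_graph (T : U →ₗ.[ℝ] V) :
    (tensorRight T E W₁ W₂).graph = tensorRightGraph T E W₁ W₂ := by
  have key : ∀ p ∈ tensorRightGraph T E W₁ W₂, ∀ y : X, ∃ a : T.domain,
      ∀ x, p.1 (y, x) = (a : U) x ∧ p.2 (y, x) = (T a) x := by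
    intro p hp y
    induction hp using Submodule.span_induction with
    | mem p hp =>
      obtain ⟨b, a, h₁, h₂⟩ := hp
      refine ⟨b y • a, fun x => ⟨?_, ?_⟩⟩
      · rw [h₁, Submodule.coe_smul, BanachFunctionSpace.smul_apply]
      · rw [h₂, LinearPMap.map_smul, BanachFunctionSpace.smul_apply]
    | zero =>
      refine ⟨0, fun x => ⟨?_, ?_⟩⟩
      · simp [BanachFunctionSpace.zero_apply]
      · simp [BanachFunctionSpace.zero_apply]
    | add p q _ _ hp hq =>
      obtain ⟨a, ha⟩ := hp
      obtain ⟨b, hb⟩ := hq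
      refine ⟨a + b, fun x => ⟨?_, ?_⟩⟩
      · rw [Prod.fst_add, Submodule.coe_add, BanachFunctionSpace.add_apply,
          BanachFunctionSpace.add_apply, (ha x).1, (hb x).1]
      · rw [Prod.snd_add, LinearPMap.map_add, BanachFunctionSpace.add_apply,
          BanachFunctionSpace.add_apply, (ha x).2, (hb x).2]
    | smul c p _ hp =>
      obtain ⟨a, ha⟩ := hp
      refine ⟨c • a, fun x => ⟨?_, ?_⟩⟩
      · rw [Prod.smul_fst, Submodule.coe_smul, BanachFunctionSpace.smul_apply,
          BanachFunctionSpace.smul_apply, (ha x).1]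
      · rw [Prod.smul_snd, LinearPMap.map_smul, BanachFunctionSpace.smul_apply,
          BanachFunctionSpace.smul_apply, (ha x).2]
  refine Submodule.toLinearPMap_graph_eq _ fun p hp h0 => ?_
  refine DFunLike.ext _ _ fun z => ?_
  obtain ⟨a, ha⟩ := key p hp z.1
  have ha0 : a = 0 := by
    refine Subtype.ext (DFunLike.ext _ _ fun x => ?_)
    rw [← (ha x).1, h0, BanachFunctionSpace.zero_apply, Submodule.coe_zero,
      BanachFunctionSpace.zero_apply]
  have h := (ha z.2).2
  rwa [ha0, LinearPMap.map_zero, BanachFunctionSpace.zero_apply,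
    ← BanachFunctionSpace.zero_apply (U := W₂) z] at h

end Tensor

/-- The domain of the adjoint `T* : dom T* ⊆ V' → U'` of an operator `T : dom T ⊆ U → V`: the
bounded functionals `φ` on `V` for which some bounded functional `ψ` on `U` satisfies
`ψ a = φ (T a)` for all `a ∈ dom T` (then `T* φ = ψ`, which is unique if `dom T` is dense). -/
def adjointDomain {U V : Type*} [NormedAddCommGroup U] [NormedSpace ℝ U]
    [NormedAddCommGroup V] [NormedSpace ℝ V] (T : U →ₗ.[ℝ] V) :
    Submodule ℝ (StrongDual ℝ V) where
  carrier := {φ | ∃ ψ : StrongDual ℝ U, ∀ a : T.domain, ψ a = φ (T a)}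
  add_mem' := by
    rintro φ₁ φ₂ ⟨ψ₁, h₁⟩ ⟨ψ₂, h₂⟩
    exact ⟨ψ₁ + ψ₂, fun a => by simp [h₁ a, h₂ a]⟩
  zero_mem' := ⟨0, fun a => by simp⟩
  smul_mem' := by
    rintro c φ ⟨ψ, h⟩
    exact ⟨c • ψ, fun a => by simp [h a]⟩

/-- The pointwise mean function of a stochastic process. -/
noncomputable def meanFun {X Ω : Type*} [MeasurableSpace Ω] (P : Measure Ω) (u : Ω → X → ℝ) :
    X → ℝ :=
  fun x => ∫ ω, u ω x ∂P

/-- The pointwise covariance function of a stochastic process. -/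
noncomputable def covFun {X Ω : Type*} [MeasurableSpace Ω] (P : Measure Ω) (u : Ω → X → ℝ) :
    X × X → ℝ :=
  fun p => cov[fun ω => u ω p.1, fun ω => u ω p.2; P]

/-- `u ∼ GP(m, k)`: all finite-dimensional marginals of `u` are (possibly degenerate) Gaussian,
with mean vector and covariance matrix given by `m` and `k`. -/
structure IsGP {X Ω : Type*} [MeasurableSpace Ω] (P : Measure Ω) (u : Ω → X → ℝ)
    (m : X → ℝ) (k : X × X → ℝ) : Prop where
  gaussian : IsGaussianProcess (fun x ω => u ω x) P
  mean_eq : meanFun P u = m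
  cov_eq : covFun P u = k

/-!
The closed operator `T` commutes with Bochner integrals, because an integral of points of a closed
subspace (here its graph) stays in the subspace: `LinearPMap.IsClosed.integral_mem_graph`. Applied
to `(u, T u)`, this is the statement about the means.

For the covariances, `T ⊗ I` is closable since `(φ ⊗ δ_y) ∘ (T ⊗ I) = T*φ ⊗ δ_y` is bounded for `φ`
in the domain of the adjoint. This domain is norm dense and `φ ↦ φ ⊗ δ_y` is bounded, so the
functionals `φ ⊗ δ_y` separate the points of the codomain (`tensorLeft_isClosable`). The covariance
functions are the Bochner integrals `E[(u - m_u) ⊗ (u - m_u)]`, and `E[(u - m_u) ⊗ (v - m_v)]` is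
the intermediate element. The integrands are related pointwise by `T ⊗ I` or `I ⊗ T`, so
`LinearPMap.IsClosed.integral_mem_graph` for the closures gives `k_v = T₁ T₂ k_u = T₂ T₁ k_u`
(`crossCov_mem_graph_tensorLeft`, `crossCov_mem_graph_tensorRight`).

Gaussianity is an argument in `L²(P)`. If `Y ∈ L²(P)` is orthogonal to all `u(x)`, then
`E[Y u] ∈ 𝒰` vanishes at every point, so `E[Y u] = 0` and `E[Y v] = T E[Y u] = 0`: `Y` is
orthogonal to all `v(x)`. Hence the `v(x)` lie in the `L²`-closed span of the `u(x)`
(`LinearPMap.IsClosed.toLp_apply_mem_closure_span`), which consists of Gaussian variables because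
`L²`-limits of Gaussian variables are Gaussian (`isClosed_setOf_hasGaussianLaw`).
-/

/-! ### Functionals on completed tensor products, and closability of `T ⊗ I` and `I ⊗ T` -/

namespace BanachFunctionSpace

variable {X U : Type*} [NormedAddCommGroup U] [NormedSpace ℝ U] [BanachFunctionSpace X U]

/-- The point evaluation `f ↦ f x`, as a bounded functional. -/
noncomputable def evalCLM (U : Type*) [NormedAddCommGroup U] [NormedSpace ℝ U]
    [BanachFunctionSpace X U] (x : X) : StrongDual ℝ U :=
  (ContinuousLinearMap.proj x).comp (coeCLM (U := U))

@[simp]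
theorem evalCLM_apply (x : X) (f : U) : evalCLM U x f = f x := rfl

theorem sub_apply (f g : U) (x : X) : (f - g) x = f x - g x :=
  map_sub (evalCLM U x) f g

end BanachFunctionSpace

open BanachFunctionSpace (evalCLM evalCLM_apply)

section Tensor

variable {X U V E W W₁ W₂ : Type*}
  [NormedAddCommGroup U] [NormedSpace ℝ U] [BanachFunctionSpace X U]
  [NormedAddCommGroup V] [NormedSpace ℝ V] [BanachFunctionSpace X V]
  [NormedAddCommGroup E] [NormedSpace ℝ E] [BanachFunctionSpace X E]
  [NormedAddCommGroup W] [NormedSpace ℝ W] [BanachFunctionSpace (X × X) W]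
  [NormedAddCommGroup W₁] [NormedSpace ℝ W₁] [BanachFunctionSpace (X × X) W₁]
  [NormedAddCommGroup W₂] [NormedSpace ℝ W₂] [BanachFunctionSpace (X × X) W₂]

theorem IsTmul.unique {a : U} {b : E} {w w' : W} (h : IsTmul a b w) (h' : IsTmul a b w') :
    w = w' :=
  DFunLike.ext _ _ fun z => (h z.1 z.2).trans (h' z.1 z.2).symm

namespace IsTensorCompletion

/-- The tensor product `(a, b) ↦ a ⊗ b` as a bounded bilinear map into the completion. -/
theorem exists_bilin (hW : IsTensorCompletion U E W) :
    ∃ B : U →L[ℝ] E →L[ℝ] W, ∀ a b, IsTmul a b (B a b) := by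
  choose t ht using hW.exists_tmul
  obtain ⟨C, hC⟩ := hW.norm_tmul_le
  let B : U →ₗ[ℝ] E →ₗ[ℝ] W := LinearMap.mk₂ ℝ t
    (fun a a' b => DFunLike.ext _ _ fun ⟨x, y⟩ => by
      simp only [ht _ _ x y, BanachFunctionSpace.add_apply]; ring)
    (fun c a b => DFunLike.ext _ _ fun ⟨x, y⟩ => by
      simp only [ht _ _ x y, BanachFunctionSpace.smul_apply]; ring)
    (fun a b b' => DFunLike.ext _ _ fun ⟨x, y⟩ => by
      simp only [ht _ _ x y, BanachFunctionSpace.add_apply]; ring)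
    (fun c a b => DFunLike.ext _ _ fun ⟨x, y⟩ => by
      simp only [ht _ _ x y, BanachFunctionSpace.smul_apply]; ring)
  exact ⟨B.mkContinuous₂ C fun a b => hC a b _ (ht a b), ht⟩

/-- Bounded functionals on the completion are determined by their values on the `a ⊗ b`. -/
theorem dual_ext (hW : IsTensorCompletion U E W) {Φ Ψ : StrongDual ℝ W}
    (h : ∀ (a : U) (b : E) (w : W), IsTmul a b w → Φ w = Ψ w) : Φ = Ψ :=
  ContinuousLinearMap.ext_on hW.dense_span fun w ⟨a, b, hw⟩ => h a b w hw

/-- The tensor product `(φ, ψ) ↦ φ ⊗ ψ` of functionals as a bounded bilinear map into the dual of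
the completion. -/
theorem exists_dual_bilin (hW : IsTensorCompletion U E W) :
    ∃ D : StrongDual ℝ U →L[ℝ] StrongDual ℝ E →L[ℝ] StrongDual ℝ W,
      ∀ φ ψ (a : U) (b : E) (w : W), IsTmul a b w → D φ ψ w = φ a * ψ b := by
  obtain ⟨C, hC⟩ := hW.exists_dual_tmul
  choose t htC ht using hC
  let D : StrongDual ℝ U →ₗ[ℝ] StrongDual ℝ E →ₗ[ℝ] StrongDual ℝ W := LinearMap.mk₂ ℝ t
    (fun φ φ' ψ => hW.dual_ext fun a b w hw => by simp [ht _ _ a b w hw]; ring)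
    (fun c φ ψ => hW.dual_ext fun a b w hw => by simp [ht _ _ a b w hw]; ring)
    (fun φ ψ ψ' => hW.dual_ext fun a b w hw => by simp [ht _ _ a b w hw]; ring)
    (fun c φ ψ => hW.dual_ext fun a b w hw => by simp [ht _ _ a b w hw]; ring)
  exact ⟨D.mkContinuous₂ C htC, ht⟩

/-- `δ_x ⊗ δ_y` is the point evaluation at `(x, y)`. -/
theorem dual_bilin_evalCLM (hW : IsTensorCompletion U E W)
    {D : StrongDual ℝ U →L[ℝ] StrongDual ℝ E →L[ℝ] StrongDual ℝ W}
    (hD : ∀ φ ψ (a : U) (b : E) (w : W), IsTmul a b w → D φ ψ w = φ a * ψ b) (x y : X) :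
    D (evalCLM U x) (evalCLM E y) = evalCLM W (x, y) :=
  hW.dual_ext fun a b w hw => (hD _ _ a b w hw).trans (hw x y).symm

end IsTensorCompletion

theorem LinearPMap.isClosable_of_graph {F G : Type*} [NormedAddCommGroup F] [NormedSpace ℝ F]
    [NormedAddCommGroup G] [NormedSpace ℝ G] {f : F →ₗ.[ℝ] G}
    (h : ∀ p ∈ f.graph.topologicalClosure, p.1 = 0 → p.2 = 0) : f.IsClosable :=
  ⟨f.graph.topologicalClosure.toLinearPMap, (Submodule.toLinearPMap_graph_eq _ h).symm⟩

/-- Identities `Ψ p.1 = Φ p.2` between bounded functionals pass from a span to its closure. -/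
theorem eq_of_mem_closure_span {F G : Type*} [NormedAddCommGroup F] [NormedSpace ℝ F]
    [NormedAddCommGroup G] [NormedSpace ℝ G] {s : Set (F × G)} {Ψ : StrongDual ℝ F}
    {Φ : StrongDual ℝ G} (h : ∀ p ∈ s, Ψ p.1 = Φ p.2) {p : F × G}
    (hp : p ∈ (Submodule.span ℝ s).topologicalClosure) : Ψ p.1 = Φ p.2 := by
  let L : F × G →L[ℝ] ℝ := Ψ.comp (.fst ℝ F G) - Φ.comp (.snd ℝ F G)
  have hL : (Submodule.span ℝ s).topologicalClosure ≤ LinearMap.ker L.toLinearMap := by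
    refine Submodule.topologicalClosure_minimal _ (Submodule.span_le.2 fun q hq => ?_)
      L.isClosed_ker
    simpa [L, sub_eq_zero] using h q hq
  simpa [L, sub_eq_zero] using hL hp

/-- For `φ` in the domain of the adjoint, `(φ ⊗ δ_y) ∘ (T ⊗ I) = T*φ ⊗ δ_y` is bounded. As such `φ`
are norm dense, the functionals `φ ⊗ δ_y` separate the points of the codomain. -/
theorem tensorLeft_isClosable {T : U →ₗ.[ℝ] V} (hW₁ : IsTensorCompletion U E W₁)
    (hW₂ : IsTensorCompletion V E W₂)
    (hT' : Dense (adjointDomain T : Set (StrongDual ℝ V))) :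
    (tensorLeft T E W₁ W₂).IsClosable := by
  obtain ⟨D₁, hD₁⟩ := hW₁.exists_dual_bilin
  obtain ⟨D₂, hD₂⟩ := hW₂.exists_dual_bilin
  refine LinearPMap.isClosable_of_graph fun p hp hp0 => DFunLike.ext _ _ fun ⟨x, y⟩ => ?_
  rw [tensorLeft_graph] at hp
  have key : ∀ φ : StrongDual ℝ V, D₂ φ (evalCLM E y) p.2 = 0 := by
    have hc : IsClosed {φ : StrongDual ℝ V | D₂ φ (evalCLM E y) p.2 = 0} :=
      isClosed_eq (by fun_prop) continuous_const
    refine fun φ => hc.closure_subset_iff.2 ?_ (hT' φ)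
    rintro φ ⟨ψ, hψ⟩
    have h := eq_of_mem_closure_span (Ψ := D₁ ψ (evalCLM E y)) (Φ := D₂ φ (evalCLM E y)) ?_ hp
    · rw [hp0, map_zero] at h
      exact h.symm
    · rintro q ⟨a, b, h₁, h₂⟩
      rw [hD₁ _ _ _ _ _ h₁, hD₂ _ _ _ _ _ h₂, hψ]
  rw [BanachFunctionSpace.zero_apply, ← evalCLM_apply (x, y) p.2, ← hW₂.dual_bilin_evalCLM hD₂, key]

theorem tensorRight_isClosable {T : U →ₗ.[ℝ] V} (hW₁ : IsTensorCompletion E U W₁)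
    (hW₂ : IsTensorCompletion E V W₂)
    (hT' : Dense (adjointDomain T : Set (StrongDual ℝ V))) :
    (tensorRight T E W₁ W₂).IsClosable := by
  obtain ⟨D₁, hD₁⟩ := hW₁.exists_dual_bilin
  obtain ⟨D₂, hD₂⟩ := hW₂.exists_dual_bilin
  refine LinearPMap.isClosable_of_graph fun p hp hp0 => DFunLike.ext _ _ fun ⟨y, x⟩ => ?_
  rw [tensorRight_graph] at hp
  have key : ∀ φ : StrongDual ℝ V, D₂ (evalCLM E y) φ p.2 = 0 := by
    have hc : IsClosed {φ : StrongDual ℝ V | D₂ (evalCLM E y) φ p.2 = 0} :=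
      isClosed_eq (by fun_prop) continuous_const
    refine fun φ => hc.closure_subset_iff.2 ?_ (hT' φ)
    rintro φ ⟨ψ, hψ⟩
    have h := eq_of_mem_closure_span (Ψ := D₁ (evalCLM E y) ψ) (Φ := D₂ (evalCLM E y) φ) ?_ hp
    · rw [hp0, map_zero] at h
      exact h.symm
    · rintro q ⟨b, a, h₁, h₂⟩
      rw [hD₁ _ _ _ _ _ h₁, hD₂ _ _ _ _ _ h₂, hψ]
  rw [BanachFunctionSpace.zero_apply, ← evalCLM_apply (y, x) p.2, ← hW₂.dual_bilin_evalCLM hD₂, key]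

theorem mem_tensorLeft_graph {T : U →ₗ.[ℝ] V} {B₁ : U →L[ℝ] E →L[ℝ] W₁}
    {B₂ : V →L[ℝ] E →L[ℝ] W₂} (hB₁ : ∀ a b, IsTmul a b (B₁ a b))
    (hB₂ : ∀ a b, IsTmul a b (B₂ a b)) {a : U} {c : V} (h : (a, c) ∈ T.graph) (b : E) :
    (B₁ a b, B₂ c b) ∈ (tensorLeft T E W₁ W₂).graph := by
  obtain ⟨a', rfl, rfl⟩ := (LinearPMap.mem_graph_iff T).1 h
  rw [tensorLeft_graph]
  exact Submodule.subset_span ⟨a', b, hB₁ _ _, hB₂ _ _⟩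

theorem mem_tensorRight_graph {T : U →ₗ.[ℝ] V} {B₁ : E →L[ℝ] U →L[ℝ] W₁}
    {B₂ : E →L[ℝ] V →L[ℝ] W₂} (hB₁ : ∀ b a, IsTmul b a (B₁ b a))
    (hB₂ : ∀ b a, IsTmul b a (B₂ b a)) {a : U} {c : V} (h : (a, c) ∈ T.graph) (b : E) :
    (B₁ b a, B₂ b c) ∈ (tensorRight T E W₁ W₂).graph := by
  obtain ⟨a', rfl, rfl⟩ := (LinearPMap.mem_graph_iff T).1 h
  rw [tensorRight_graph]
  exact Submodule.subset_span ⟨b, a', hB₁ _ _, hB₂ _ _⟩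

/-- `a ⊗ b` is the limit of `aₙ ⊗ b` with `aₙ ∈ dom T`. -/
theorem tensorLeft_dense_domain {T : U →ₗ.[ℝ] V} (hW₁ : IsTensorCompletion U E W₁)
    (hW₂ : IsTensorCompletion V E W₂) (hT : Dense (T.domain : Set U)) :
    Dense ((tensorLeft T E W₁ W₂).domain : Set W₁) := by
  obtain ⟨B₁, hB₁⟩ := hW₁.exists_bilin
  obtain ⟨B₂, hB₂⟩ := hW₂.exists_bilin
  rw [Submodule.dense_iff_topologicalClosure_eq_top, eq_top_iff,
    ← Submodule.dense_iff_topologicalClosure_eq_top.1 hW₁.dense_span]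
  refine Submodule.topologicalClosure_minimal _ (Submodule.span_le.2 ?_)
    (Submodule.isClosed_topologicalClosure _)
  rintro w ⟨a, b, hw⟩
  rw [hw.unique (hB₁ a b)]
  refine map_mem_closure (f := fun a => B₁ a b) (by fun_prop) (hT a) fun a' ha' => ?_
  exact LinearPMap.mem_domain_of_mem_graph
    (mem_tensorLeft_graph hB₁ hB₂ (T.mem_graph ⟨a', ha'⟩) b)

theorem tensorRight_dense_domain {T : U →ₗ.[ℝ] V} (hW₁ : IsTensorCompletion E U W₁)
    (hW₂ : IsTensorCompletion E V W₂) (hT : Dense (T.domain : Set U)) :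
    Dense ((tensorRight T E W₁ W₂).domain : Set W₁) := by
  obtain ⟨B₁, hB₁⟩ := hW₁.exists_bilin
  obtain ⟨B₂, hB₂⟩ := hW₂.exists_bilin
  rw [Submodule.dense_iff_topologicalClosure_eq_top, eq_top_iff,
    ← Submodule.dense_iff_topologicalClosure_eq_top.1 hW₁.dense_span]
  refine Submodule.topologicalClosure_minimal _ (Submodule.span_le.2 ?_)
    (Submodule.isClosed_topologicalClosure _)
  rintro w ⟨b, a, hw⟩
  rw [hw.unique (hB₁ b a)]
  refine map_mem_closure (f := fun a => B₁ b a) (by fun_prop) (hT a) fun a' ha' => ?_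
  exact LinearPMap.mem_domain_of_mem_graph
    (mem_tensorRight_graph hB₁ hB₂ (T.mem_graph ⟨a', ha'⟩) b)

end Tensor

/-! ### Closed operators, Bochner integrals and cross-covariances -/

section Integral

variable {Ω F G : Type*} [MeasurableSpace Ω] {P : Measure Ω}
  [NormedAddCommGroup F] [NormedSpace ℝ F] [CompleteSpace F]
  [NormedAddCommGroup G] [NormedSpace ℝ G] [CompleteSpace G]

theorem LinearPMap.exists_of_mem_graph {F G : Type*} [AddCommGroup F] [Module ℝ F]
    [AddCommGroup G] [Module ℝ G] {S : F →ₗ.[ℝ] G} {p : F × G} (h : p ∈ S.graph) :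
    ∃ hp : p.1 ∈ S.domain, S ⟨p.1, hp⟩ = p.2 := by
  obtain ⟨⟨a, ha⟩, h₁, h₂⟩ := (LinearPMap.mem_graph_iff S).1 h
  subst h₁
  exact ⟨ha, h₂⟩

/-- Hille's theorem: a closed operator commutes with the Bochner integral. -/
theorem LinearPMap.IsClosed.integral_mem_graph [IsProbabilityMeasure P] {S : F →ₗ.[ℝ] G}
    (hS : S.IsClosed) {f : Ω → F} {g : Ω → G} (hf : Integrable f P) (hg : Integrable g P)
    (h : ∀ᵐ ω ∂P, (f ω, g ω) ∈ S.graph) : (∫ ω, f ω ∂P, ∫ ω, g ω ∂P) ∈ S.graph := by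
  rw [← integral_pair hf hg]
  exact S.graph.convex.integral_mem hS h (hf.prodMk hg)

theorem ProbabilityTheory.covariance_congr_ae {Y Y' Z Z' : Ω → ℝ} (hY : Y =ᵐ[P] Y')
    (hZ : Z =ᵐ[P] Z') : cov[Y, Z; P] = cov[Y', Z'; P] := by
  rw [covariance, covariance, integral_congr_ae hY, integral_congr_ae hZ]
  refine integral_congr_ae ?_
  filter_upwards [hY, hZ] with ω h₁ h₂
  rw [h₁, h₂]

variable {X : Type*} [BanachFunctionSpace X F]

theorem BanachFunctionSpace.integral_apply {f : Ω → F} (hf : Integrable f P) (x : X) :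
    (∫ ω, f ω ∂P) x = ∫ ω, f ω x ∂P :=
  ((evalCLM F x).integral_comp_comm hf).symm

variable {U V E W W₁ W₂ : Type*}
  [NormedAddCommGroup U] [NormedSpace ℝ U] [BanachFunctionSpace X U]
  [NormedAddCommGroup V] [NormedSpace ℝ V] [BanachFunctionSpace X V]
  [NormedAddCommGroup E] [NormedSpace ℝ E] [BanachFunctionSpace X E]
  [NormedAddCommGroup W] [NormedSpace ℝ W] [BanachFunctionSpace (X × X) W]
  [NormedAddCommGroup W₁] [NormedSpace ℝ W₁] [BanachFunctionSpace (X × X) W₁]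
  [NormedAddCommGroup W₂] [NormedSpace ℝ W₂] [BanachFunctionSpace (X × X) W₂]

/-- The cross-covariance `E[(f - E f) ⊗ (g - E g)]` of two random elements, with respect to a
bounded bilinear map `B` in the role of `⊗`. -/
noncomputable def crossCov (P : Measure Ω) (B : U →L[ℝ] E →L[ℝ] W) (f : Ω → U) (g : Ω → E) : W :=
  ∫ ω, B (f ω - ∫ ω', f ω' ∂P) (g ω - ∫ ω', g ω' ∂P) ∂P

theorem integrable_crossCov [IsFiniteMeasure P] (B : U →L[ℝ] E →L[ℝ] W) {f : Ω → U} {g : Ω → E}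
    (hf : MemLp f 2 P) (hg : MemLp g 2 P) :
    Integrable (fun ω => B (f ω - ∫ ω', f ω' ∂P) (g ω - ∫ ω', g ω' ∂P)) P :=
  memLp_one_iff_integrable.1 <|
    B.memLp_of_bilin 1 (hf.sub (memLp_const _)) (hg.sub (memLp_const _))

/-- The cross-covariance element represents the pointwise covariances. -/
theorem crossCov_apply [CompleteSpace U] [CompleteSpace E] [CompleteSpace W]
    [IsFiniteMeasure P] {B : U →L[ℝ] E →L[ℝ] W}
    (hB : ∀ a b, IsTmul a b (B a b)) {f : Ω → U} {g : Ω → E}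
    (hf : MemLp f 2 P) (hg : MemLp g 2 P) (x y : X) :
    crossCov P B f g (x, y) = cov[fun ω => f ω x, fun ω => g ω y; P] := by
  rw [crossCov, BanachFunctionSpace.integral_apply (integrable_crossCov B hf hg), covariance]
  refine integral_congr_ae (.of_forall fun ω => ?_)
  simp only [hB _ _ x y, BanachFunctionSpace.sub_apply,
    BanachFunctionSpace.integral_apply (hf.integrable one_le_two),
    BanachFunctionSpace.integral_apply (hg.integrable one_le_two)]

variable [CompleteSpace W₁] [CompleteSpace W₂] [IsProbabilityMeasure P]
  {T : U →ₗ.[ℝ] V} {f : Ω → U} {g : Ω → V} {b : Ω → E}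

theorem LinearPMap.IsClosed.sub_integral_mem_graph [CompleteSpace U] [CompleteSpace V]
    (hT : T.IsClosed) (hf : Integrable f P) (hg : Integrable g P)
    (h : ∀ᵐ ω ∂P, (f ω, g ω) ∈ T.graph) :
    ∀ᵐ ω ∂P, (f ω - ∫ ω', f ω' ∂P, g ω - ∫ ω', g ω' ∂P) ∈ T.graph := by
  filter_upwards [h] with ω hω using T.graph.sub_mem hω (hT.integral_mem_graph hf hg h)

/-- The closure of `T ⊗ I` maps the cross-covariance of `u` and `b` to that of `T u` and `b`. -/
theorem crossCov_mem_graph_tensorLeft [CompleteSpace U] [CompleteSpace V]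
    (hT : T.IsClosed) {B₁ : U →L[ℝ] E →L[ℝ] W₁} {B₂ : V →L[ℝ] E →L[ℝ] W₂}
    (hB₁ : ∀ a b, IsTmul a b (B₁ a b)) (hB₂ : ∀ a b, IsTmul a b (B₂ a b))
    (hcl : (tensorLeft T E W₁ W₂).IsClosable)
    (hf : MemLp f 2 P) (hg : MemLp g 2 P) (hb : MemLp b 2 P)
    (h : ∀ᵐ ω ∂P, (f ω, g ω) ∈ T.graph) :
    (crossCov P B₁ f b, crossCov P B₂ g b) ∈ (tensorLeft T E W₁ W₂).closure.graph := by
  refine hcl.closure_isClosed.integral_mem_graph (integrable_crossCov B₁ hf hb)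
    (integrable_crossCov B₂ hg hb) ?_
  filter_upwards [hT.sub_integral_mem_graph (hf.integrable one_le_two)
    (hg.integrable one_le_two) h] with ω hω
  exact LinearPMap.le_graph_of_le (LinearPMap.le_closure _) (mem_tensorLeft_graph hB₁ hB₂ hω _)

/-- The closure of `I ⊗ T` maps the cross-covariance of `b` and `u` to that of `b` and `T u`. -/
theorem crossCov_mem_graph_tensorRight [CompleteSpace U] [CompleteSpace V]
    (hT : T.IsClosed) {B₁ : E →L[ℝ] U →L[ℝ] W₁} {B₂ : E →L[ℝ] V →L[ℝ] W₂}
    (hB₁ : ∀ a b, IsTmul a b (B₁ a b)) (hB₂ : ∀ a b, IsTmul a b (B₂ a b))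
    (hcl : (tensorRight T E W₁ W₂).IsClosable)
    (hf : MemLp f 2 P) (hg : MemLp g 2 P) (hb : MemLp b 2 P)
    (h : ∀ᵐ ω ∂P, (f ω, g ω) ∈ T.graph) :
    (crossCov P B₁ b f, crossCov P B₂ b g) ∈ (tensorRight T E W₁ W₂).closure.graph := by
  refine hcl.closure_isClosed.integral_mem_graph (integrable_crossCov B₁ hb hf)
    (integrable_crossCov B₂ hb hg) ?_
  filter_upwards [hT.sub_integral_mem_graph (hf.integrable one_le_two)
    (hg.integrable one_le_two) h] with ω hω
  exact LinearPMap.le_graph_of_le (LinearPMap.le_closure _) (mem_tensorRight_graph hB₁ hB₂ hω _)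

end Integral

/-! ### Gaussian processes and `L²` limits -/

section Gaussian

open Filter Topology

variable {Ω : Type*} [MeasurableSpace Ω] {P : Measure Ω}

/-- Limits in `L²` of Gaussian random variables are Gaussian: characteristic functions, means and
variances converge. -/
theorem isClosed_setOf_hasGaussianLaw [IsProbabilityMeasure P] :
    IsClosed {f : Lp ℝ 2 P | HasGaussianLaw f P} := by
  refine IsSeqClosed.isClosed fun f g hf hfg => ?_
  have hmeas (f : Lp ℝ 2 P) : AEMeasurable f P := (Lp.aestronglyMeasurable f).aemeasurable
  have hchar (t : ℝ) : Tendsto (fun n => charFun (P.map (f n)) t) atTop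
      (𝓝 (charFun (P.map g) t)) :=
    ProbabilityMeasure.tendsto_iff_tendsto_charFun.1
      ((tendstoInMeasure_of_tendsto_Lp hfg).tendstoInDistribution_of_aemeasurable
        (fun n => hmeas _) (hmeas _)).tendsto t
  have hint : Continuous fun h : Lp ℝ 2 P => ∫ ω, h ω ∂P := by
    have : (fun h : Lp ℝ 2 P => ∫ ω, h ω ∂P) =
        fun h => inner ℝ ((memLp_const (1 : ℝ)).toLp (fun _ : Ω => (1 : ℝ))) h := by
      ext h
      rw [L2.inner_def]
      refine integral_congr_ae ?_
      filter_upwards [(memLp_const (μ := P) (p := 2) (1 : ℝ)).coeFn_toLp] with ω hω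
      rw [hω]
      simp
    rw [this]
    fun_prop
  have hvar : Continuous fun h : Lp ℝ 2 P => Var[h; P] := by
    have : (fun h : Lp ℝ 2 P => Var[h; P]) =
        fun h => inner ℝ h h - (∫ ω, h ω ∂P) ^ 2 := by
      ext h
      rw [variance_eq_sub (Lp.memLp h), L2.inner_def]
      simp [sq]
    rw [this]
    fun_prop
  rw [Set.mem_ofPred_eq, hasGaussianLaw_iff_charFun_map_eq (hmeas g)]
  intro t
  refine tendsto_nhds_unique (hchar t) ?_
  have h1 : Tendsto (fun n => ∫ ω, f n ω ∂P) atTop (𝓝 (∫ ω, g ω ∂P)) :=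
    (hint.tendsto g).comp hfg
  have h2 : Tendsto (fun n => Var[f n; P]) atTop (𝓝 Var[g; P]) := (hvar.tendsto g).comp hfg
  have hexp (h : Ω → ℝ) : Complex.exp ((P[fun ω ↦ inner ℝ t (h ω)] : ℝ) * Complex.I -
      Var[fun ω ↦ inner ℝ t (h ω); P] / 2) =
      Complex.exp ((t * ∫ ω, h ω ∂P : ℝ) * Complex.I - (t ^ 2 * Var[h; P] : ℝ) / 2) := by
    have : (fun ω ↦ inner ℝ t (h ω)) = fun ω => t * h ω := by ext; simp [mul_comm]
    rw [this, integral_const_mul, variance_const_mul]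
  simp only [(hf _).charFun_map_eq, hexp]
  have hcont : Continuous fun p : ℝ × ℝ =>
      Complex.exp ((t * p.1 : ℝ) * Complex.I - (t ^ 2 * p.2 : ℝ) / 2) := by fun_prop
  exact (hcont.tendsto _).comp (h1.prodMk_nhds h2)

/-- Finite linear combinations of a Gaussian process are Gaussian. -/
theorem ProbabilityTheory.IsGaussianProcess.hasGaussianLaw_linearCombination {X : Type*}
    {Z : X → Ω → ℝ} (hZ : IsGaussianProcess Z P) (c : X →₀ ℝ) :
    HasGaussianLaw (fun ω => c.sum fun x r => r * Z x ω) P := by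
  let L : (c.support → ℝ) →L[ℝ] ℝ := ∑ x : c.support, c x • ContinuousLinearMap.proj x
  refine ((hZ.hasGaussianLaw c.support).map L).congr (.of_forall fun ω => ?_)
  simpa [L, Finsupp.sum, Finset.restrict] using
    Finset.sum_coe_sort c.support fun x => c x * Z x ω

theorem MeasureTheory.MemLp.coeFn_sum_smul_toLp {ι : Type*} {W : ι → Ω → ℝ}
    (hW : ∀ i, MemLp (W i) 2 P) (s : Finset ι) (c : ι → ℝ) :
    ⇑(∑ i ∈ s, c i • (hW i).toLp) =ᵐ[P] fun ω => ∑ i ∈ s, c i * W i ω := by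
  have h1 : ∀ᵐ ω ∂P, ∀ i ∈ s, (c i • (hW i).toLp) ω = c i * W i ω := by
    refine (ae_ball_iff s.countable_toSet).2 fun i _ => ?_
    filter_upwards [Lp.coeFn_smul (c i) (hW i).toLp, (hW i).coeFn_toLp] with ω h1 h2
    rw [h1, Pi.smul_apply, h2, smul_eq_mul]
  filter_upwards [Lp.coeFn_finsetSum s fun i => c i • (hW i).toLp, h1] with ω h2 h3
  rw [h2, Finset.sum_apply]
  exact Finset.sum_congr rfl h3

/-- A process whose values lie in the `L²`-closed linear span of a Gaussian process is Gaussian. -/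
theorem ProbabilityTheory.IsGaussianProcess.of_mem_closure_span
    [IsProbabilityMeasure P] {X Y : Type*} {Z : X → Ω → ℝ}
    {Z' : Y → Ω → ℝ} (hZ : IsGaussianProcess Z P) (hZ2 : ∀ x, MemLp (Z x) 2 P)
    (hZ'2 : ∀ y, MemLp (Z' y) 2 P)
    (h : ∀ y, (hZ'2 y).toLp ∈
      (Submodule.span ℝ (Set.range fun x => (hZ2 x).toLp)).topologicalClosure) :
    IsGaussianProcess Z' P := by
  classical
  have key : ∀ f ∈ (Submodule.span ℝ (Set.range fun x => (hZ2 x).toLp)).topologicalClosure,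
      HasGaussianLaw f P := by
    refine fun f hf => isClosed_setOf_hasGaussianLaw.closure_subset_iff.2 (fun f hf => ?_) hf
    obtain ⟨c, rfl⟩ := Finsupp.mem_span_range_iff_exists_finsupp.1 hf
    exact (hZ.hasGaussianLaw_linearCombination c).congr
      (MemLp.coeFn_sum_smul_toLp hZ2 c.support c).symm
  refine ⟨fun I => ⟨isGaussian_of_isGaussian_map fun L => ?_⟩⟩
  have hmeas : AEMeasurable (fun ω => I.restrict (Z' · ω)) P :=
    aemeasurable_pi_lambda _ fun i => (hZ'2 i).aestronglyMeasurable.aemeasurable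
  have hmem : ∑ i : I, L (Pi.single i 1) • (hZ'2 i).toLp ∈
      (Submodule.span ℝ (Set.range fun x => (hZ2 x).toLp)).topologicalClosure :=
    Submodule.sum_mem _ fun i _ => Submodule.smul_mem _ _ (h i)
  have hlaw := (key _ hmem).congr
    (MemLp.coeFn_sum_smul_toLp (fun i : I => hZ'2 i) Finset.univ fun i => L (Pi.single i 1))
  rw [AEMeasurable.map_map_of_aemeasurable (by fun_prop) hmeas]
  have hL : ⇑L ∘ (fun ω => I.restrict (Z' · ω)) =
      fun ω => ∑ i : I, L (Pi.single i 1) * Z' i ω := by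
    ext ω
    have := L.toLinearMap.pi_apply_eq_sum_univ (I.restrict (Z' · ω))
    simp only [ContinuousLinearMap.coe_coe] at this
    rw [Function.comp_apply, this]
    refine Finset.sum_congr rfl fun i _ => ?_
    rw [smul_eq_mul, mul_comm]
    congr 2
    ext j
    simp [Pi.single_apply, eq_comm]
  rw [hL]
  exact hlaw.isGaussian_map

end Gaussian

/-! ### Values of a closed operator and closed linear spans in `L²` -/

section Orthogonality

variable {X Ω U V : Type*} [MeasurableSpace Ω] {P : Measure Ω}
  [NormedAddCommGroup U] [NormedSpace ℝ U] [BanachFunctionSpace X U]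
  [NormedAddCommGroup V] [NormedSpace ℝ V] [BanachFunctionSpace X V]
  {T : U →ₗ.[ℝ] V} {f : Ω → U} {g : Ω → V}

theorem BanachFunctionSpace.memLp_apply (hf : MemLp f 2 P) (x : X) :
    MemLp (fun ω => f ω x) 2 P :=
  (evalCLM U x).comp_memLp' hf

theorem BanachFunctionSpace.integrable_L2_smul (Y : Lp ℝ 2 P) (hf : MemLp f 2 P) :
    Integrable (fun ω => Y ω • f ω) P :=
  memLp_one_iff_integrable.1 (hf.smul (Lp.memLp Y))

/-- The inner product of `Y` with the evaluation of `f` at `x` is the value of `E[Y f]` at `x`. -/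
theorem BanachFunctionSpace.inner_toLp_apply [CompleteSpace U] (Y : Lp ℝ 2 P) (hf : MemLp f 2 P) (x : X) :
    inner ℝ Y (memLp_apply hf x).toLp = (∫ ω, Y ω • f ω ∂P) x := by
  rw [integral_apply (integrable_L2_smul Y hf), L2.inner_def]
  refine integral_congr_ae ?_
  filter_upwards [(memLp_apply hf x).coeFn_toLp] with ω hω
  rw [hω, BanachFunctionSpace.smul_apply]
  simp [mul_comm]

/-- If `Y ∈ L²` is orthogonal to all `u x`, then `E[Y u] ∈ U` vanishes at every point, so
`E[Y T u] = T E[Y u] = 0` and `Y` is orthogonal to all `(T u) x`. Hence the latter lie in the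
closed span, which is its own double orthogonal complement. -/
theorem LinearPMap.IsClosed.toLp_apply_mem_closure_span [CompleteSpace U]
    [CompleteSpace V] [IsProbabilityMeasure P] (hT : T.IsClosed) (hf : MemLp f 2 P)
    (hg : MemLp g 2 P) (h : ∀ᵐ ω ∂P, (f ω, g ω) ∈ T.graph) (x : X) :
    (BanachFunctionSpace.memLp_apply hg x).toLp ∈ (Submodule.span ℝ
      (Set.range fun y => (BanachFunctionSpace.memLp_apply hf y).toLp)).topologicalClosure := by
  rw [← Submodule.orthogonal_orthogonal_eq_closure, Submodule.mem_orthogonal]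
  intro Y hY
  have h0 : ∫ ω, Y ω • f ω ∂P = 0 := by
    refine DFunLike.ext _ _ fun y => ?_
    rw [← BanachFunctionSpace.inner_toLp_apply Y hf y, BanachFunctionSpace.zero_apply, real_inner_comm]
    exact (Submodule.mem_orthogonal _ Y).1 hY _ (Submodule.subset_span ⟨y, rfl⟩)
  have hmem : (∫ ω, Y ω • f ω ∂P, ∫ ω, Y ω • g ω ∂P) ∈ T.graph := by
    refine hT.integral_mem_graph (BanachFunctionSpace.integrable_L2_smul Y hf)
      (BanachFunctionSpace.integrable_L2_smul Y hg) ?_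
    filter_upwards [h] with ω hω using T.graph.smul_mem (Y ω) hω
  rw [BanachFunctionSpace.inner_toLp_apply Y hg, LinearPMap.graph_fst_eq_zero_snd T hmem h0,
    BanachFunctionSpace.zero_apply]

end Orthogonality

/-! ### Mean, covariance and Gaussianity of the transformed process -/

theorem theorem1 {X Ω U V WUU WUV WVU WVV : Type*}
    [NormedAddCommGroup U] [NormedSpace ℝ U] [CompleteSpace U] [BanachFunctionSpace X U]
    [NormedAddCommGroup V] [NormedSpace ℝ V] [CompleteSpace V] [BanachFunctionSpace X V]
    -- the completed tensor products, as Banach spaces of functions on `X × X`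
    [NormedAddCommGroup WUU] [NormedSpace ℝ WUU] [BanachFunctionSpace (X × X) WUU]
    [NormedAddCommGroup WUV] [NormedSpace ℝ WUV] [BanachFunctionSpace (X × X) WUV]
    [NormedAddCommGroup WVU] [NormedSpace ℝ WVU] [BanachFunctionSpace (X × X) WVU]
    [NormedAddCommGroup WVV] [NormedSpace ℝ WVV] [BanachFunctionSpace (X × X) WVV]
    (hUU : IsTensorCompletion U U WUU) (hUV : IsTensorCompletion U V WUV)
    (hVU : IsTensorCompletion V U WVU) (hVV : IsTensorCompletion V V WVV)
    (T : U →ₗ.[ℝ] V) (hT : T.IsClosed)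
    [MeasurableSpace Ω] (P : Measure Ω) [IsProbabilityMeasure P]
    (u v : Ω → X → ℝ)
    -- almost surely `u ω ∈ dom T` and `v ω = T (u ω)`
    (huv : ∀ᵐ ω ∂P, ∃ a : T.domain, ⇑(a : U) = u ω ∧ ⇑(T a) = v ω)
    -- `u` and `v` regarded as random elements of `U` and `V`
    (u' : Ω → U) (v' : Ω → V)
    (hu' : ∀ᵐ ω ∂P, ⇑(u' ω) = u ω) (hv' : ∀ᵐ ω ∂P, ⇑(v' ω) = v ω)
    -- `u` and `v` are Bochner integrable
    (hu : Integrable u' P) (hv : Integrable v' P) :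
    -- (a)
    ((∀ x, Integrable (fun ω => u ω x) P) ∧ (∀ x, Integrable (fun ω => v ω x) P) ∧
      ⇑(∫ ω, u' ω ∂P) = meanFun P u ∧ ⇑(∫ ω, v' ω ∂P) = meanFun P v ∧
      ∃ h : ∫ ω, u' ω ∂P ∈ T.domain, T ⟨∫ ω, u' ω ∂P, h⟩ = ∫ ω, v' ω ∂P) ∧
    (Dense (T.domain : Set U) → Dense (adjointDomain T : Set (StrongDual ℝ V)) →
      MemLp u' 2 P → MemLp v' 2 P →
      -- (b): `T ⊗ I` and `I ⊗ T` have densely defined closures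
      (((tensorLeft T U WUU WVU).IsClosable ∧
          Dense ((tensorLeft T U WUU WVU).closure.domain : Set WUU)) ∧
        ((tensorLeft T V WUV WVV).IsClosable ∧
          Dense ((tensorLeft T V WUV WVV).closure.domain : Set WUV)) ∧
        ((tensorRight T U WUU WUV).IsClosable ∧
          Dense ((tensorRight T U WUU WUV).closure.domain : Set WUU)) ∧
        ((tensorRight T V WVU WVV).IsClosable ∧
          Dense ((tensorRight T V WVU WVV).closure.domain : Set WVU)) ∧
        (∀ x, MemLp (fun ω => u ω x) 2 P) ∧ (∀ x, MemLp (fun ω => v ω x) 2 P) ∧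
        ∃ (ku : WUU) (kv : WVV), ⇑ku = covFun P u ∧ ⇑kv = covFun P v ∧
          (∃ (h₂ : ku ∈ (tensorRight T U WUU WUV).closure.domain)
            (h₁ : (tensorRight T U WUU WUV).closure ⟨ku, h₂⟩ ∈
              (tensorLeft T V WUV WVV).closure.domain),
            kv = (tensorLeft T V WUV WVV).closure
              ⟨(tensorRight T U WUU WUV).closure ⟨ku, h₂⟩, h₁⟩) ∧
          (∃ (h₁ : ku ∈ (tensorLeft T U WUU WVU).closure.domain)
            (h₂ : (tensorLeft T U WUU WVU).closure ⟨ku, h₁⟩ ∈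
              (tensorRight T V WVU WVV).closure.domain),
            kv = (tensorRight T V WVU WVV).closure
              ⟨(tensorLeft T U WUU WVU).closure ⟨ku, h₁⟩, h₂⟩)) ∧
      -- (c)
      (IsGP P u (meanFun P u) (covFun P u) → (∀ n : ℕ, MemLp v' n P) →
        ∃ (mu : T.domain) (ku : WUU), ⇑(mu : U) = meanFun P u ∧ ⇑ku = covFun P u ∧
          ∃ (h₂ : ku ∈ (tensorRight T U WUU WUV).closure.domain)
            (h₁ : (tensorRight T U WUU WUV).closure ⟨ku, h₂⟩ ∈
              (tensorLeft T V WUV WVV).closure.domain),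
            IsGP P v ⇑(T mu) ⇑((tensorLeft T V WUV WVV).closure
              ⟨(tensorRight T U WUU WUV).closure ⟨ku, h₂⟩, h₁⟩))) := by
  have hcUU := hUU.complete
  have hcUV := hUV.complete
  have hcVU := hVU.complete
  have hcVV := hVV.complete
  have hgraph : ∀ᵐ ω ∂P, (u' ω, v' ω) ∈ T.graph := by
    filter_upwards [huv, hu', hv'] with ω ⟨a, ha, hTa⟩ h₁ h₂
    rw [← DFunLike.coe_injective (ha.trans h₁.symm), ← DFunLike.coe_injective (hTa.trans h₂.symm)]
    exact T.mem_graph a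
  have hux : ∀ x, (fun ω => u' ω x) =ᵐ[P] fun ω => u ω x := fun x => by
    filter_upwards [hu'] with ω h using congrFun h x
  have hvx : ∀ x, (fun ω => v' ω x) =ᵐ[P] fun ω => v ω x := fun x => by
    filter_upwards [hv'] with ω h using congrFun h x
  have hmu : ⇑(∫ ω, u' ω ∂P) = meanFun P u := funext fun x =>
    (BanachFunctionSpace.integral_apply hu x).trans (integral_congr_ae (hux x))
  have hmv : ⇑(∫ ω, v' ω ∂P) = meanFun P v := funext fun x =>
    (BanachFunctionSpace.integral_apply hv x).trans (integral_congr_ae (hvx x))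
  obtain ⟨hdom, hTm⟩ := LinearPMap.exists_of_mem_graph (hT.integral_mem_graph hu hv hgraph)
  refine ⟨⟨fun x => ((evalCLM U x).integrable_comp hu).congr (hux x),
    fun x => ((evalCLM V x).integrable_comp hv).congr (hvx x), hmu, hmv, hdom, hTm⟩, ?_⟩
  intro hTd hTd' hu2 hv2
  have hux2 : ∀ x, MemLp (fun ω => u ω x) 2 P := fun x =>
    (memLp_congr_ae (hux x)).1 (BanachFunctionSpace.memLp_apply hu2 x)
  have hvx2 : ∀ x, MemLp (fun ω => v ω x) 2 P := fun x =>
    (memLp_congr_ae (hvx x)).1 (BanachFunctionSpace.memLp_apply hv2 x)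
  have cLU := tensorLeft_isClosable hUU hVU hTd'
  have cLV := tensorLeft_isClosable hUV hVV hTd'
  have cRU := tensorRight_isClosable hUU hUV hTd'
  have cRV := tensorRight_isClosable hVU hVV hTd'
  obtain ⟨BUU, hBUU⟩ := hUU.exists_bilin
  obtain ⟨BUV, hBUV⟩ := hUV.exists_bilin
  obtain ⟨BVU, hBVU⟩ := hVU.exists_bilin
  obtain ⟨BVV, hBVV⟩ := hVV.exists_bilin
  have hku : ⇑(crossCov P BUU u' u') = covFun P u := funext fun ⟨x, y⟩ =>
    (crossCov_apply hBUU hu2 hu2 x y).trans (covariance_congr_ae (hux x) (hux y))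
  have hkv : ⇑(crossCov P BVV v' v') = covFun P v := funext fun ⟨x, y⟩ =>
    (crossCov_apply hBVV hv2 hv2 x y).trans (covariance_congr_ae (hvx x) (hvx y))
  obtain ⟨dRU, eRU⟩ := LinearPMap.exists_of_mem_graph
    (crossCov_mem_graph_tensorRight hT hBUU hBUV cRU hu2 hv2 hu2 hgraph)
  obtain ⟨dLV, eLV⟩ := LinearPMap.exists_of_mem_graph
    (crossCov_mem_graph_tensorLeft hT hBUV hBVV cLV hu2 hv2 hv2 hgraph)
  obtain ⟨dLU, eLU⟩ := LinearPMap.exists_of_mem_graph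
    (crossCov_mem_graph_tensorLeft hT hBUU hBVU cLU hu2 hv2 hu2 hgraph)
  obtain ⟨dRV, eRV⟩ := LinearPMap.exists_of_mem_graph
    (crossCov_mem_graph_tensorRight hT hBVU hBVV cRV hu2 hv2 hv2 hgraph)
  dsimp only at dRU eRU dLV eLV dLU eLU dRV eRV
  refine ⟨⟨⟨cLU, (tensorLeft_dense_domain hUU hVU hTd).mono (LinearPMap.le_closure _).1⟩,
    ⟨cLV, (tensorLeft_dense_domain hUV hVV hTd).mono (LinearPMap.le_closure _).1⟩,
    ⟨cRU, (tensorRight_dense_domain hUU hUV hTd).mono (LinearPMap.le_closure _).1⟩,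
    ⟨cRV, (tensorRight_dense_domain hVU hVV hTd).mono (LinearPMap.le_closure _).1⟩,
    hux2, hvx2, crossCov P BUU u' u', crossCov P BVV v' v', hku, hkv,
    ⟨dRU, by rw [eRU]; exact dLV, by simp only [eRU, eLV]⟩,
    ⟨dLU, by rw [eLU]; exact dRV, by simp only [eLU, eRV]⟩⟩, ?_⟩
  intro hGP _
  refine ⟨⟨_, hdom⟩, crossCov P BUU u' u', hmu, hku, dRU, by rw [eRU]; exact dLV, ?_, ?_, ?_⟩
  · have hG : IsGaussianProcess (fun x ω => u' ω x) P := hGP.gaussian.congr fun x => (hux x).symm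
    exact (hG.of_mem_closure_span (BanachFunctionSpace.memLp_apply hu2)
      (BanachFunctionSpace.memLp_apply hv2)
      (hT.toLp_apply_mem_closure_span hu2 hv2 hgraph)).congr hvx
  · rw [← hmv, hTm]
  · simp only [eRU, eLV, hkv]
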